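/- Let $\Theta$ be a finite set and let $(\mathcal X,\nu)$ be a $\sigma$-finite measure space. For each $\theta\in\Theta$ let $p(\cdot\mid\theta)$ be a probability density on $\mathcal X$ with respect to $\nu$ such that $p(\cdot\mid\theta)>0$ $\nu$-a.e. (no boundedness of $p$ is assumed). Write $\Delta=\{\varphi:\Theta\to[0,1] : \sum_{\theta}\varphi(\theta)=1\}$ for the set of probability densities on $\Theta$ with respect to counting measure, and, for $\varphi\in\Delta$, let $\Pi_\varphi(x)=\sum_{\theta\in\Theta}p(x\mid\theta)\varphi(\theta)$ be the mixture density. Assume that the mixture is identifiable: if $\varphi,\psi\in\Delta$ and $\Pi_\varphi=\Pi_\psi$ $\nu$-a.e., then $\varphi=\psi$. Let $f\in\Delta$ (some of the values $f(\theta)$ may be zero), and let $X_1,X_2,\dots$ be i.i.d. $\mathcal X$-valued random variables with density $\Pi_f$ with respect to $\nu$. Let $w_1,w_2,\dots\in(0,1)$ satisfy $\sum_n w_n=\infty$ and $\sum_n w_n^2<\infty$, let $f_0\in\Delta$ with $f_0(\theta)>0$ for every $\theta\in\Theta$, and let $f_n$ be Newton's recursive estimate, defined for $n\ge 1$ by $$f_n(\theta)=(1-w_n)f_{n-1}(\theta)+w_n\,\frac{p(X_n\mid\theta)f_{n-1}(\theta)}{\Pi_{f_{n-1}}(X_n)},\qquad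 \theta\in\Theta.$$ Then, almost surely, $f_n(\theta)\to f(\theta)$ as $n\to\infty$ for every $\theta\in\Theta$. -/

import Mathlib

open MeasureTheory ProbabilityTheory Filter Topology

noncomputable section

namespace NewtonMixing

variable {𝒳 Θ : Type*}

/-- `g` is a probability density on `𝒳` with respect to `ν`. -/
structure IsProbDensity [MeasurableSpace 𝒳] (ν : Measure 𝒳) (g : 𝒳 → ℝ) : Prop where
  measurable : Measurable g
  nonneg : ∀ x, 0 ≤ g x
  lintegral_eq_one : ∫⁻ x, ENNReal.ofReal (g x) ∂ν = 1

variable [Fintype Θ]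

/-- The mixture density `Π_φ(x) = ∑_θ p(x|θ) φ(θ)`; `p x θ` stands for `p(x|θ)`, and the
integral over `Θ` with respect to counting measure is a finite sum. -/
def mixture (p : 𝒳 → Θ → ℝ) (φ : Θ → ℝ) (x : 𝒳) : ℝ :=
  ∑ θ, p x θ * φ θ

/-- Identifiability: the map `φ ↦ Π_φ` from probability vectors on `Θ` to densities
(which are identified when they agree `ν`-a.e.) is injective. -/
def Identifiable [MeasurableSpace 𝒳] (ν : Measure 𝒳) (p : 𝒳 → Θ → ℝ) : Prop :=
  ∀ φ ∈ stdSimplex ℝ Θ, ∀ ψ ∈ stdSimplex ℝ Θ,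
    mixture p φ =ᵐ[ν] mixture p ψ → φ = ψ

/-- Newton's recursive estimate computed from the data `x`. The entries `w n`, `x n` of the
sequences (indexed from `0`) are the weight and the observation used in the step that leads
from the `n`-th estimate to the `(n + 1)`-st. -/
def newtonEstimate (p : 𝒳 → Θ → ℝ) (w : ℕ → ℝ) (f₀ : Θ → ℝ) (x : ℕ → 𝒳) : ℕ → Θ → ℝ
  | 0 => f₀
  | n + 1 => fun θ =>
      (1 - w n) * newtonEstimate p w f₀ x n θ
        + w n * (p (x n) θ * newtonEstimate p w f₀ x n θ
            / mixture p (newtonEstimate p w f₀ x n) (x n))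

end NewtonMixing

end

/-
The Lyapunov function is the Kullback–Leibler divergence `K n` of `f_n` from `f`. One step changes
it by `-∑ f log (1 - w + w p(X | ·) / Π_{f_n}(X))`. The ratios may be unbounded, so before the
logarithm is expanded to first order, `Π_f / Π_{f_n}` is lowered to its truncation `R` at the
level `3`; this shows that `K` decreases by at least `w (R - 1)` up to an error of order
`w² / (1 - w)`. Given the past, `R - 1` has mean `D f_n ≥ 0`, where `D` is continuous on the simplex
and, by identifiability, vanishes only at `f`. The centred terms `w (R - 1 - D f_n)` are bounded
martingale differences with square-summable weights, so their sum converges almost surely. Hence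
`K n` converges and `∑ w_n D f_n < ∞`; as `∑ w_n = ∞`, the point `f` is a cluster point of `f_n`,
which forces `K n → 0` and thus `f_n → f`, because `K` dominates the squared Hellinger distance.
-/

namespace NewtonMixing

section Descent

/-- The deterministic form of the Robbins–Siegmund lemma. -/
theorem exists_tendsto_and_summable_of_add_le_add {K b ξ : ℕ → ℝ}
    (hK : BddBelow (Set.range K)) (hb : ∀ n, 0 ≤ b n)
    (hξ : ∃ l, Tendsto (fun n => ∑ i ∈ Finset.range n, ξ i) atTop (𝓝 l))
    (hstep : ∀ n, K (n + 1) + b n ≤ K n + ξ n) :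
    (∃ l, Tendsto K atTop (𝓝 l)) ∧ Summable b := by
  obtain ⟨k, hk⟩ := hK
  obtain ⟨l, hl⟩ := hξ
  obtain ⟨c, hc⟩ := hl.bddAbove_range
  have hKk : ∀ n, k ≤ K n := fun n => hk ⟨n, rfl⟩
  have hξc : ∀ n, ∑ i ∈ Finset.range n, ξ i ≤ c := fun n => hc ⟨n, rfl⟩
  set T : ℕ → ℝ := fun n =>
    K n + ∑ i ∈ Finset.range n, b i - ∑ i ∈ Finset.range n, ξ i with hT
  have hT_anti : Antitone T := antitone_nat_of_succ_le fun n => by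
    simp only [hT, Finset.sum_range_succ]
    linarith [hstep n]
  have hb_summable : Summable b := by
    refine summable_of_sum_range_le (c := T 0 - k + c) hb fun n => ?_
    have hTn : T n ≤ T 0 := hT_anti n.zero_le
    simp only [hT] at hTn ⊢
    linarith [hKk n, hξc n]
  have hT_bdd : BddBelow (Set.range T) := by
    refine ⟨k - c, ?_⟩
    rintro _ ⟨n, rfl⟩
    have hbn : 0 ≤ ∑ i ∈ Finset.range n, b i := Finset.sum_nonneg fun i _ => hb i
    linarith [hKk n, hξc n]
  have hlim := ((tendsto_atTop_ciInf hT_anti hT_bdd).sub hb_summable.tendsto_sum_tsum_nat).add hl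
  exact ⟨⟨_, hlim.congr fun n => by simp only [hT]; ring⟩, hb_summable⟩

theorem mapClusterPt_zero_of_summable_mul {w d : ℕ → ℝ} (hw : ∀ n, 0 ≤ w n)
    (hw_sum : ¬ Summable w) (hd : ∀ n, 0 ≤ d n) (hwd : Summable fun n => w n * d n) :
    MapClusterPt 0 atTop d := by
  rw [Metric.nhds_basis_ball.mapClusterPt_iff_frequently]
  refine fun δ hδ hfar => ?_
  refine hw_sum (Summable.of_norm_bounded_eventually_nat (hwd.mul_left δ⁻¹) ?_)
  filter_upwards [hfar] with n hn
  have hδn : δ ≤ d n := by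
    simpa [Real.dist_eq, abs_of_nonneg (hd n)] using hn
  rw [Real.norm_of_nonneg (hw n), inv_mul_eq_div, le_div_iff₀ hδ]
  exact mul_le_mul_of_nonneg_left hδn (hw n)

theorem mapClusterPt_of_mapClusterPt_comp {ι X Y : Type*} [TopologicalSpace X]
    [TopologicalSpace Y] [T2Space Y] {l : Filter ι} {u : ι → X} {s : Set X} {D : X → Y} {a : X}
    {y : Y} (hs : IsCompact s) (hD : ContinuousOn D s) (ha : ∀ x ∈ s, D x = y → x = a)
    (hu : ∀ᶠ i in l, u i ∈ s) (hDu : MapClusterPt y l (D ∘ u)) : MapClusterPt a l u := by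
  obtain ⟨U, hU, hUy⟩ := mapClusterPt_iff_ultrafilter.1 hDu
  have hUs : ∀ᶠ i in U, u i ∈ s := hU hu
  obtain ⟨x, hxs, hUx⟩ := hs.ultrafilter_le_nhds (U.map u) (le_principal_iff.2 hUs)
  have hux : Tendsto u U (𝓝[s] x) :=
    tendsto_nhdsWithin_of_tendsto_nhds_of_eventually_within _ hUx hUs
  have hDx : D x = y := tendsto_nhds_unique ((hD x hxs).tendsto.comp hux) hUy
  exact mapClusterPt_iff_ultrafilter.2 ⟨U, hU, ha x hxs hDx ▸ hUx⟩

theorem summable_sq_div_one_sub {w : ℕ → ℝ} (hw : Summable fun n => w n ^ 2) :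
    Summable fun n => w n ^ 2 / (1 - w n) := by
  have hw_small : ∀ᶠ n in atTop, w n ^ 2 < (1 / 2) ^ 2 :=
    hw.tendsto_atTop_zero.eventually (gt_mem_nhds (by norm_num))
  refine Summable.of_norm_bounded_eventually_nat (hw.mul_left 2) ?_
  filter_upwards [hw_small] with n hn
  have hwn : w n < 1 / 2 := lt_of_pow_lt_pow_left₀ 2 (by norm_num) hn
  have hden : 0 < 1 - w n := by linarith
  rw [Real.norm_of_nonneg (by positivity), div_le_iff₀ hden]
  nlinarith [sq_nonneg (w n)]

end Descent

section RelEntropy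

variable {Θ : Type*} [Fintype Θ]

/-- The Kullback–Leibler divergence `∑ f log (f / φ)` of `φ` from `f`, the Lyapunov function of
the recursion. A term with `f θ = 0` vanishes; because `Real.log 0 = 0`, a term with
`φ θ = 0 < f θ` vanishes too instead of being infinite, so that positivity of `φ` wherever `f` is
positive has to be assumed alongside. -/
noncomputable def relEntropy (f φ : Θ → ℝ) : ℝ :=
  ∑ θ, f θ * Real.log (f θ / φ θ)

variable {f φ : Θ → ℝ}

theorem relEntropy_self (f : Θ → ℝ) : relEntropy f f = 0 :=
  Finset.sum_eq_zero fun θ _ => by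
    rcases eq_or_ne (f θ) 0 with h | h
    · simp [h]
    · simp [div_self h]

theorem relEntropy_mul {y : Θ → ℝ} (hφ : ∀ θ, f θ ≠ 0 → φ θ ≠ 0) (hy : ∀ θ, f θ ≠ 0 → y θ ≠ 0) :
    relEntropy f (fun θ => φ θ * y θ) = relEntropy f φ - ∑ θ, f θ * Real.log (y θ) := by
  simp only [relEntropy, ← Finset.sum_sub_distrib, ← mul_sub]
  refine Finset.sum_congr rfl fun θ _ => ?_
  rcases eq_or_ne (f θ) 0 with h | h
  · simp [h]
  · rw [← div_div, Real.log_div (div_ne_zero h (hφ θ h)) (hy θ h)]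

theorem continuousAt_relEntropy_self (f : Θ → ℝ) : ContinuousAt (relEntropy f) f := by
  refine tendsto_finsetSum _ fun θ _ => ?_
  rcases eq_or_ne (f θ) 0 with h | h
  · simp [h]
  · have hdiv : ContinuousAt (fun φ : Θ → ℝ => f θ / φ θ) f :=
      continuousAt_const.div (continuous_apply θ).continuousAt h
    exact continuousAt_const.mul (hdiv.log (div_ne_zero h h))

theorem sq_sqrt_sub_sqrt_le {a b : ℝ} (ha : 0 ≤ a) (hb : 0 ≤ b) (hab : 0 < a → 0 < b) :
    (√a - √b) ^ 2 ≤ a * Real.log (a / b) + (b - a) := by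
  rcases ha.eq_or_lt with rfl | ha
  · simp [Real.sq_sqrt hb]
  have hb := hab ha
  have hsa := Real.sqrt_pos.2 ha
  have hsb := Real.sqrt_pos.2 hb
  have hlog : Real.log (a / b) = -(2 * Real.log (√b / √a)) := by
    rw [Real.log_div ha.ne' hb.ne', Real.log_div hsb.ne' hsa.ne', Real.log_sqrt hb.le,
      Real.log_sqrt ha.le]
    ring
  calc (√a - √b) ^ 2 = -(2 * (√a ^ 2 * (√b / √a - 1))) + (√b ^ 2 - √a ^ 2) := by
        field_simp; ring
    _ = -(2 * (a * (√b / √a - 1))) + (b - a) := by rw [Real.sq_sqrt ha.le, Real.sq_sqrt hb.le]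
    _ ≤ -(2 * (a * Real.log (√b / √a))) + (b - a) := by
        gcongr; exact Real.log_le_sub_one_of_pos (div_pos hsb hsa)
    _ = a * Real.log (a / b) + (b - a) := by rw [hlog]; ring

theorem sum_sq_sqrt_sub_sqrt_le_relEntropy (hf : ∀ θ, 0 ≤ f θ) (hφ : ∀ θ, 0 ≤ φ θ)
    (hsum : ∑ θ, φ θ ≤ ∑ θ, f θ) (hfφ : ∀ θ, 0 < f θ → 0 < φ θ) :
    ∑ θ, (√(f θ) - √(φ θ)) ^ 2 ≤ relEntropy f φ := by
  have hterms := Finset.sum_le_sum fun θ (_ : θ ∈ Finset.univ) =>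
    sq_sqrt_sub_sqrt_le (hf θ) (hφ θ) (hfφ θ)
  rw [Finset.sum_add_distrib, Finset.sum_sub_distrib] at hterms
  unfold relEntropy
  linarith

theorem tendsto_of_tendsto_relEntropy {ι : Type*} {l : Filter ι} {φ : ι → Θ → ℝ}
    (hf : ∀ θ, 0 ≤ f θ) (hφ : ∀ i θ, 0 ≤ φ i θ) (hsum : ∀ i, ∑ θ, φ i θ ≤ ∑ θ, f θ)
    (hfφ : ∀ i θ, 0 < f θ → 0 < φ i θ) (h : Tendsto (fun i => relEntropy f (φ i)) l (𝓝 0)) :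
    Tendsto φ l (𝓝 f) := by
  refine tendsto_pi_nhds.2 fun θ => ?_
  have hsq : Tendsto (fun i => (√(f θ) - √(φ i θ)) ^ 2) l (𝓝 0) :=
    squeeze_zero (fun i => sq_nonneg _) (fun i =>
      (Finset.single_le_sum (f := fun θ => (√(f θ) - √(φ i θ)) ^ 2) (fun _ _ => sq_nonneg _)
        (Finset.mem_univ θ)).trans
      (sum_sq_sqrt_sub_sqrt_le_relEntropy hf (hφ i) (hsum i) (hfφ i))) h
  have hsub : Tendsto (fun i => √(f θ) - √(φ i θ)) l (𝓝 0) :=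
    tendsto_zero_iff_abs_tendsto_zero _ |>.2 <| by
      simpa [Real.sqrt_sq_eq_abs, Function.comp_def] using hsq.sqrt
  have hsqrt : Tendsto (fun i => √(φ i θ)) l (𝓝 √(f θ)) := by
    simpa using hsub.const_sub √(f θ)
  simpa only [Real.sq_sqrt (hφ _ θ), Real.sq_sqrt (hf θ)] using hsqrt.pow 2

theorem tendsto_of_relEntropy_descent (hf : f ∈ stdSimplex ℝ Θ) {φ : ℕ → Θ → ℝ}
    (hφ : ∀ n, φ n ∈ stdSimplex ℝ Θ) (hfφ : ∀ n θ, 0 < f θ → 0 < φ n θ)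
    {D : (Θ → ℝ) → ℝ} (hD_cont : ContinuousOn D (stdSimplex ℝ Θ))
    (hD_nonneg : ∀ ψ ∈ stdSimplex ℝ Θ, 0 ≤ D ψ)
    (hD_zero : ∀ ψ ∈ stdSimplex ℝ Θ, D ψ = 0 → ψ = f)
    {w ξ : ℕ → ℝ} (hw : ∀ n, 0 ≤ w n) (hw_sum : ¬ Summable w)
    (hξ : ∃ l, Tendsto (fun n => ∑ i ∈ Finset.range n, ξ i) atTop (𝓝 l))
    (hstep : ∀ n, relEntropy f (φ (n + 1)) + w n * D (φ n) ≤ relEntropy f (φ n) + ξ n) :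
    Tendsto φ atTop (𝓝 f) := by
  have hsum : ∀ n, ∑ θ, φ n θ ≤ ∑ θ, f θ := fun n => ((hφ n).2.trans hf.2.symm).le
  have hK_nonneg : ∀ n, 0 ≤ relEntropy f (φ n) := fun n =>
    (Finset.sum_nonneg fun _ _ => sq_nonneg _).trans
      (sum_sq_sqrt_sub_sqrt_le_relEntropy hf.1 (hφ n).1 (hsum n) (hfφ n))
  have hDφ : ∀ n, 0 ≤ D (φ n) := fun n => hD_nonneg _ (hφ n)
  obtain ⟨⟨l, hl⟩, hwD⟩ := exists_tendsto_and_summable_of_add_le_add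
    ⟨0, Set.forall_mem_range.2 hK_nonneg⟩ (fun n => mul_nonneg (hw n) (hDφ n)) hξ hstep
  have hcluster : MapClusterPt f atTop φ :=
    mapClusterPt_of_mapClusterPt_comp (isCompact_stdSimplex ℝ Θ) hD_cont hD_zero
      (Eventually.of_forall hφ) (mapClusterPt_zero_of_summable_mul hw hw_sum hDφ hwD)
  have hl_zero : 0 = l := by
    have hK_cluster := hcluster.continuousAt_comp (continuousAt_relEntropy_self f)
    rw [relEntropy_self] at hK_cluster
    have : (𝓝 0 ⊓ 𝓝 l).NeBot := ClusterPt.mono hK_cluster hl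
    exact eq_of_nhds_neBot this
  exact tendsto_of_tendsto_relEntropy hf.1 (fun n => (hφ n).1) hsum hfφ (hl_zero ▸ hl)

end RelEntropy

section MartingaleDifference

variable {Ω : Type*} {mΩ : MeasurableSpace Ω} {P : Measure Ω} {ℱ : Filtration ℕ mΩ}
  {ξ : ℕ → Ω → ℝ}

theorem stronglyMeasurable_sum_range (hξ : ∀ n, StronglyMeasurable[ℱ (n + 1)] (ξ n)) (n : ℕ) :
    StronglyMeasurable[ℱ n] (∑ i ∈ Finset.range n, ξ i) :=
  Finset.stronglyMeasurable_sum _ fun i hi =>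
    (hξ i).mono (ℱ.mono (Finset.mem_range.1 hi))

theorem memLp_sum_range (hξ : ∀ n, MemLp (ξ n) 2 P) (n : ℕ) :
    MemLp (∑ i ∈ Finset.range n, ξ i) 2 P :=
  memLp_finsetSum' _ fun i _ => hξ i

theorem martingale_sum_range [IsFiniteMeasure P]
    (hξ : ∀ n, StronglyMeasurable[ℱ (n + 1)] (ξ n)) (hξ_int : ∀ n, Integrable (ξ n) P)
    (hξ_cond : ∀ n, P[ξ n | ℱ n] =ᵐ[P] 0) :
    Martingale (fun n => ∑ i ∈ Finset.range n, ξ i) ℱ P := by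
  refine martingale_of_condExp_sub_eq_zero_nat (stronglyMeasurable_sum_range hξ)
    (fun n => integrable_finsetSum' _ fun i _ => hξ_int i) fun n => ?_
  rw [Finset.sum_range_succ, add_sub_cancel_left]
  exact hξ_cond n

theorem integral_mul_eq_zero_of_condExp_eq_zero {m : MeasurableSpace Ω} (hm : m ≤ mΩ)
    [SigmaFinite (P.trim hm)] {U V : Ω → ℝ} (hU : StronglyMeasurable[m] U)
    (hUV : Integrable (U * V) P) (hV : Integrable V P) (hV_cond : P[V | m] =ᵐ[P] 0) :
    ∫ ω, U ω * V ω ∂P = 0 := by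
  calc ∫ ω, U ω * V ω ∂P = ∫ ω, (P[U * V | m]) ω ∂P := (integral_condExp hm).symm
    _ = ∫ ω, (U * P[V | m]) ω ∂P :=
        integral_congr_ae (condExp_mul_of_stronglyMeasurable_left hU hUV hV)
    _ = 0 := integral_eq_zero_of_ae <| hV_cond.mono fun ω hω => by simp [hω]

theorem integral_sq_sum_range [IsFiniteMeasure P]
    (hξ : ∀ n, StronglyMeasurable[ℱ (n + 1)] (ξ n)) (hξ_L2 : ∀ n, MemLp (ξ n) 2 P)
    (hξ_cond : ∀ n, P[ξ n | ℱ n] =ᵐ[P] 0) (n : ℕ) :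
    ∫ ω, (∑ i ∈ Finset.range n, ξ i) ω ^ 2 ∂P
      = ∑ i ∈ Finset.range n, ∫ ω, ξ i ω ^ 2 ∂P := by
  induction n with
  | zero => simp
  | succ n ih =>
    set M := ∑ i ∈ Finset.range n, ξ i
    have hM : MemLp M 2 P := memLp_sum_range hξ_L2 n
    have hMξ : Integrable (M * ξ n) P := hM.integrable_mul (hξ_L2 n)
    have hcross : ∫ ω, M ω * ξ n ω ∂P = 0 :=
      integral_mul_eq_zero_of_condExp_eq_zero (ℱ.le n) (stronglyMeasurable_sum_range hξ n) hMξ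
        ((hξ_L2 n).integrable one_le_two) (hξ_cond n)
    have hMξ_two : Integrable (fun ω => 2 * (M ω * ξ n ω)) P := hMξ.const_mul 2
    have hM_add : Integrable (fun ω => M ω ^ 2 + 2 * (M ω * ξ n ω)) P :=
      hM.integrable_sq.add hMξ_two
    calc ∫ ω, (∑ i ∈ Finset.range (n + 1), ξ i) ω ^ 2 ∂P
        = ∫ ω, (M ω ^ 2 + 2 * (M ω * ξ n ω) + ξ n ω ^ 2) ∂P := by
          rw [Finset.sum_range_succ]
          congr with ω
          simp only [Pi.add_apply, M]
          ring
      _ = ∫ ω, M ω ^ 2 ∂P + 2 * ∫ ω, M ω * ξ n ω ∂P + ∫ ω, ξ n ω ^ 2 ∂P := by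
          rw [integral_add hM_add (hξ_L2 n).integrable_sq,
            integral_add hM.integrable_sq hMξ_two, integral_const_mul]
      _ = ∑ i ∈ Finset.range (n + 1), ∫ ω, ξ i ω ^ 2 ∂P := by
          rw [ih, hcross, mul_zero, add_zero, Finset.sum_range_succ]

theorem eLpNorm_one_le_of_integral_sq_le [IsProbabilityMeasure P] {U : Ω → ℝ}
    (hU : MemLp U 2 P) {R : ℝ} (hR : ∫ ω, U ω ^ 2 ∂P ≤ R) :
    eLpNorm U 1 P ≤ ENNReal.ofReal √R := by
  refine (eLpNorm_le_eLpNorm_of_exponent_le one_le_two hU.aestronglyMeasurable).trans ?_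
  rw [hU.eLpNorm_eq_integral_rpow_norm two_ne_zero ENNReal.ofNat_ne_top]
  refine ENNReal.ofReal_le_ofReal ?_
  simpa [Real.sqrt_eq_rpow] using Real.sqrt_le_sqrt hR

theorem ae_exists_tendsto_sum_of_condExp_eq_zero [IsProbabilityMeasure P]
    (hξ : ∀ n, StronglyMeasurable[ℱ (n + 1)] (ξ n)) (hξ_L2 : ∀ n, MemLp (ξ n) 2 P)
    (hξ_cond : ∀ n, P[ξ n | ℱ n] =ᵐ[P] 0) (hξ_sum : Summable fun n => ∫ ω, ξ n ω ^ 2 ∂P) :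
    ∀ᵐ ω ∂P, ∃ l, Tendsto (fun n => ∑ i ∈ Finset.range n, ξ i ω) atTop (𝓝 l) := by
  have hM := martingale_sum_range hξ (fun n => (hξ_L2 n).integrable one_le_two) hξ_cond
  have hM_bdd : ∀ n, eLpNorm (∑ i ∈ Finset.range n, ξ i) 1 P
      ≤ ENNReal.ofReal √(∑' i, ∫ ω, ξ i ω ^ 2 ∂P) := fun n =>
    eLpNorm_one_le_of_integral_sq_le (memLp_sum_range hξ_L2 n) <|
      (integral_sq_sum_range hξ hξ_L2 hξ_cond n).trans_le <|
        hξ_sum.sum_le_tsum _ fun i _ => integral_nonneg fun ω => sq_nonneg _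
  simpa only [Finset.sum_apply] using hM.submartingale.exists_ae_tendsto_of_bdd hM_bdd

theorem ae_exists_tendsto_sum_mul_sub_condExp [IsProbabilityMeasure P] {G : ℕ → Ω → ℝ} {B : ℝ}
    (hG : ∀ n, StronglyMeasurable[ℱ (n + 1)] (G n)) (hGB : ∀ n ω, |G n ω| ≤ B)
    {w : ℕ → ℝ} (hw : Summable fun n => w n ^ 2) :
    ∀ᵐ ω ∂P, ∃ l, Tendsto
      (fun n => ∑ i ∈ Finset.range n, w i * (G i ω - P[G i | ℱ i] ω)) atTop (𝓝 l) := by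
  have hG_int : ∀ n, Integrable (G n) P := fun n =>
    Integrable.of_bound ((hG n).mono (ℱ.le _)).aestronglyMeasurable B
      (Eventually.of_forall (hGB n))
  set ξ : ℕ → Ω → ℝ := fun n => w n • (G n - P[G n | ℱ n]) with hξ_def
  have hξ : ∀ n, StronglyMeasurable[ℱ (n + 1)] (ξ n) := fun n =>
    ((hG n).sub (stronglyMeasurable_condExp.mono (ℱ.mono n.le_succ))).const_smul (w n)
  have hξ_bdd : ∀ n, ∀ᵐ ω ∂P, |ξ n ω| ≤ |w n| * (B + B) := fun n => by
    filter_upwards [ae_bdd_abs_condExp_of_ae_bdd_abs (m := ℱ n)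
      (Eventually.of_forall (hGB n))] with ω hω
    simp only [hξ_def, Pi.smul_apply, Pi.sub_apply, smul_eq_mul, abs_mul]
    exact mul_le_mul_of_nonneg_left ((abs_sub _ _).trans (add_le_add (hGB n ω) hω)) (abs_nonneg _)
  have hξ_L2 : ∀ n, MemLp (ξ n) 2 P := fun n =>
    MemLp.of_bound ((hξ n).mono (ℱ.le _)).aestronglyMeasurable _ (hξ_bdd n)
  have hξ_cond : ∀ n, P[ξ n | ℱ n] =ᵐ[P] 0 := fun n => by
    filter_upwards [condExp_smul (μ := P) (w n) (G n - P[G n | ℱ n]) (ℱ n),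
      condExp_sub (hG_int n) integrable_condExp (ℱ n)] with ω hsmul hsub
    rw [hsmul, Pi.smul_apply, hsub, Pi.sub_apply,
      condExp_of_stronglyMeasurable (ℱ.le n) stronglyMeasurable_condExp integrable_condExp]
    simp
  have hξ_sum : Summable fun n => ∫ ω, ξ n ω ^ 2 ∂P := by
    refine Summable.of_nonneg_of_le (fun n => integral_nonneg fun ω => sq_nonneg _) (fun n => ?_)
      (hw.mul_right ((B + B) ^ 2))
    calc ∫ ω, ξ n ω ^ 2 ∂P ≤ ∫ _, w n ^ 2 * (B + B) ^ 2 ∂P :=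
          integral_mono_ae (hξ_L2 n).integrable_sq (integrable_const _) <|
            (hξ_bdd n).mono fun ω hω => by
              have := pow_le_pow_left₀ (abs_nonneg _) hω 2
              rwa [mul_pow, sq_abs, sq_abs] at this
      _ = w n ^ 2 * (B + B) ^ 2 := by simp
  exact ae_exists_tendsto_sum_of_condExp_eq_zero hξ hξ_L2 hξ_cond hξ_sum

end MartingaleDifference

section Freezing

variable {Ω 𝒳 E : Type*} {m mΩ : MeasurableSpace Ω} [m𝒳 : MeasurableSpace 𝒳] [MeasurableSpace E]
  {P : Measure Ω} [IsFiniteMeasure P] {X : Ω → 𝒳} {Z : Ω → E}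

theorem map_prodMk_restrict_of_indep (hm : m ≤ mΩ) (hZ : Measurable[m] Z) (hX : Measurable X)
    (hind : Indep m (m𝒳.comap X) P) {s : Set Ω} (hs : MeasurableSet[m] s) :
    (P.restrict s).map (fun ω => (Z ω, X ω)) = ((P.restrict s).map Z).prod (P.map X) := by
  have hZ' : Measurable Z := hZ.mono hm le_rfl
  refine (Measure.prod_eq fun A B hA hB => ?_).symm
  have hZA : MeasurableSet[m] (Z ⁻¹' A) := hZ hA
  rw [Measure.map_apply (hZ'.prodMk hX) (hA.prod hB), Measure.map_apply hZ' hA,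
    Measure.map_apply hX hB, Measure.restrict_apply ((hZ'.prodMk hX) (hA.prod hB)),
    Measure.restrict_apply (hZ' hA), Set.mk_preimage_prod, Set.inter_right_comm]
  exact (Indep_iff _ _ _).1 hind _ _ (hZA.inter hs) ⟨B, hB, rfl⟩

theorem condExp_comp_prodMk_of_indep (hm : m ≤ mΩ) (hZ : Measurable[m] Z) (hX : Measurable X)
    (hind : Indep m (m𝒳.comap X) P) {g : E × 𝒳 → ℝ} (hg : Measurable g)
    (hg_int : Integrable (fun ω => g (Z ω, X ω)) P) :
    P[fun ω => g (Z ω, X ω) | m] =ᵐ[P] fun ω => ∫ x, g (Z ω, x) ∂(P.map X) := by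
  have hZ' : Measurable Z := hZ.mono hm le_rfl
  have hg_frozen : StronglyMeasurable fun z => ∫ x, g (z, x) ∂(P.map X) :=
    hg.stronglyMeasurable.integral_prod_right'
  have hg_prod : ∀ s, MeasurableSet[m] s →
      Integrable g (((P.restrict s).map Z).prod (P.map X)) := fun s hs => by
    rw [← map_prodMk_restrict_of_indep hm hZ hX hind hs,
      integrable_map_measure hg.aestronglyMeasurable (hZ'.prodMk hX).aemeasurable]
    exact hg_int.integrableOn
  refine (ae_eq_condExp_of_forall_setIntegral_eq hm hg_int (fun s hs _ => ?_) (fun s hs _ => ?_)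
    (hg_frozen.comp_measurable hZ).aestronglyMeasurable).symm
  · exact (hg_prod s hs).integral_prod_left.comp_measurable hZ'
  · calc ∫ ω in s, ∫ x, g (Z ω, x) ∂(P.map X) ∂P
        = ∫ z, ∫ x, g (z, x) ∂(P.map X) ∂((P.restrict s).map Z) :=
          (integral_map hZ'.aemeasurable hg_frozen.aestronglyMeasurable).symm
      _ = ∫ y, g y ∂((P.restrict s).map fun ω => (Z ω, X ω)) := by
          rw [map_prodMk_restrict_of_indep hm hZ hX hind hs, integral_prod _ (hg_prod s hs)]
      _ = ∫ ω in s, g (Z ω, X ω) ∂P :=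
          integral_map (hZ'.prodMk hX).aemeasurable hg.aestronglyMeasurable

end Freezing

section StrictPast

variable {Ω 𝒳 : Type*} [mΩ : MeasurableSpace Ω] [m𝒳 : MeasurableSpace 𝒳]

/-- The filtration whose `n`-th member is generated by the observations strictly before `n`; it
is the shifted natural filtration, for which `X n` is independent of the `n`-th member. -/
def strictPast (X : ℕ → Ω → 𝒳) (hX : ∀ n, Measurable (X n)) : Filtration ℕ mΩ where
  seq n := ⨆ i ∈ Set.Iio n, m𝒳.comap (X i)
  mono' _ _ hmn := biSup_mono fun _ hi => lt_of_lt_of_le hi hmn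
  le' _ := iSup₂_le fun i _ => (hX i).comap_le

variable {X : ℕ → Ω → 𝒳} (hX : ∀ n, Measurable (X n))

theorem measurable_strictPast_succ (n : ℕ) : Measurable[strictPast X hX (n + 1)] (X n) :=
  (comap_measurable (X n)).mono
    (le_iSup₂_of_le (f := fun i (_ : i ∈ Set.Iio (n + 1)) => m𝒳.comap (X i)) n n.lt_succ_self
      le_rfl) le_rfl

theorem indep_strictPast {P : Measure Ω} (hind : iIndepFun X P) (n : ℕ) :
    Indep (strictPast X hX n) (m𝒳.comap (X n)) P := by
  have h := indep_iSup_of_disjoint (fun i => (hX i).comap_le) ((iIndepFun_iff_iIndep _ _ _).1 hind)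
    (S := Set.Iio n) (T := {n}) (by simp)
  exact indep_of_indep_of_le_right h (by simp)

end StrictPast

section CappedDiv

/-- The quotient `a / t` capped at `3`, written so that for `0 < a` it is continuous in `t` also
at `t = 0`. With any cap above `2` the inequality `2 a - t ≤ a * cappedDiv a t`, an equality at
`t = a`, is strict elsewhere on `0 ≤ t`. -/
noncomputable def cappedDiv (a t : ℝ) : ℝ :=
  a / max t (a / 3)

variable {a t : ℝ}

theorem cappedDiv_nonneg (ha : 0 ≤ a) : 0 ≤ cappedDiv a t :=
  div_nonneg ha (le_max_of_le_right (by positivity))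

theorem cappedDiv_le_three (ha : 0 ≤ a) : cappedDiv a t ≤ 3 := by
  refine div_le_of_le_mul₀ (le_max_of_le_right (by positivity)) (by norm_num) ?_
  linarith [le_max_right t (a / 3)]

theorem abs_cappedDiv_le_three (ha : 0 ≤ a) : |cappedDiv a t| ≤ 3 := by
  rw [abs_of_nonneg (cappedDiv_nonneg ha)]
  exact cappedDiv_le_three ha

theorem cappedDiv_le_div (ha : 0 ≤ a) (ht : 0 < t) : cappedDiv a t ≤ a / t :=
  div_le_div_of_nonneg_left ha ht (le_max_left _ _)

theorem cappedDiv_self (ha : 0 < a) : cappedDiv a a = 1 := by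
  rw [cappedDiv, max_eq_left (by linarith), div_self ha.ne']

theorem two_mul_sub_lt_mul_cappedDiv (ha : 0 ≤ a) (ht : 0 ≤ t) (hta : t ≠ a) :
    2 * a - t < a * cappedDiv a t := by
  rcases ha.eq_or_lt with rfl | ha
  · simpa using ht.lt_of_ne' hta
  rcases le_total t (a / 3) with h | h
  · rw [cappedDiv, max_eq_right h, div_div_cancel₀ ha.ne']
    linarith
  · have ht : 0 < t := by linarith
    rw [cappedDiv, max_eq_left h, ← sub_pos]
    have hgap : a * (a / t) - (2 * a - t) = (a - t) ^ 2 / t := by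
      field_simp
      ring
    rw [hgap]
    exact div_pos (sq_pos_of_ne_zero (sub_ne_zero.2 hta.symm)) ht

theorem two_mul_sub_le_mul_cappedDiv (ha : 0 ≤ a) (ht : 0 ≤ t) :
    2 * a - t ≤ a * cappedDiv a t := by
  rcases eq_or_ne t a with rfl | hta
  · rcases ha.eq_or_lt with rfl | ha
    · simp
    · rw [cappedDiv_self ha]
      linarith
  · exact (two_mul_sub_lt_mul_cappedDiv ha ht hta).le

theorem continuous_cappedDiv (ha : 0 < a) : Continuous (cappedDiv a) :=
  continuous_const.div (continuous_id.max continuous_const) fun _ =>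
    (lt_max_of_lt_right (by positivity)).ne'

theorem measurable_cappedDiv {α : Type*} [MeasurableSpace α] {g h : α → ℝ} (hg : Measurable g)
    (hh : Measurable h) : Measurable fun y => cappedDiv (g y) (h y) :=
  hg.div (hh.max (hg.div_const 3))

end CappedDiv

section NewtonStep

theorem one_sub_add_mul_pos {w u : ℝ} (hw : w ∈ Set.Ico (0 : ℝ) 1) (hu : 0 ≤ u) :
    0 < 1 - w + w * u :=
  add_pos_of_pos_of_nonneg (sub_pos.2 hw.2) (mul_nonneg hw.1 hu)

theorem mul_sub_one_sub_le_log {w u v c : ℝ} (hw : w ∈ Set.Ico (0 : ℝ) 1) (hv : 0 ≤ v)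
    (hvu : v ≤ u) (hvc : v ≤ c) :
    w * (v - 1) - (c + 1) ^ 2 * (w ^ 2 / (1 - w)) ≤ Real.log (1 - w + w * u) := by
  have hw_sub : 0 < 1 - w := sub_pos.2 hw.2
  have hwv : 0 < 1 - w + w * v := one_sub_add_mul_pos hw hv
  have hremainder : (w * (v - 1)) ^ 2 / (1 - w + w * v) ≤ (c + 1) ^ 2 * (w ^ 2 / (1 - w)) := by
    rw [← mul_div_assoc, mul_pow, mul_comm (w ^ 2)]
    refine div_le_div₀ (by positivity) ?_ hw_sub (le_add_of_nonneg_right (mul_nonneg hw.1 hv))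
    exact mul_le_mul_of_nonneg_right (by nlinarith) (sq_nonneg w)
  calc w * (v - 1) - (c + 1) ^ 2 * (w ^ 2 / (1 - w))
      ≤ w * (v - 1) - (w * (v - 1)) ^ 2 / (1 - w + w * v) := by gcongr
    _ = 1 - (1 - w + w * v)⁻¹ := by field_simp; ring
    _ ≤ Real.log (1 - w + w * v) := Real.one_sub_inv_le_log_of_pos hwv
    _ ≤ Real.log (1 - w + w * u) := Real.log_le_log hwv (by gcongr; exact hw.1)

variable {𝒳 Θ : Type*} [Fintype Θ] {p : 𝒳 → Θ → ℝ} {f φ : Θ → ℝ} {x : 𝒳} {w : ℝ}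

theorem mixture_nonneg (hp : ∀ θ, 0 ≤ p x θ) (hφ : ∀ θ, 0 ≤ φ θ) : 0 ≤ mixture p φ x :=
  Finset.sum_nonneg fun θ _ => mul_nonneg (hp θ) (hφ θ)

theorem mul_le_mixture (hp : ∀ θ, 0 ≤ p x θ) (hφ : ∀ θ, 0 ≤ φ θ) (θ : Θ) :
    p x θ * φ θ ≤ mixture p φ x :=
  Finset.single_le_sum (f := fun θ => p x θ * φ θ) (fun θ _ => mul_nonneg (hp θ) (hφ θ))
    (Finset.mem_univ θ)

theorem mixture_pos_of_mixture_pos (hp : ∀ θ, 0 ≤ p x θ) (hf : ∀ θ, 0 ≤ f θ) (hφ : ∀ θ, 0 ≤ φ θ)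
    (hfφ : ∀ θ, 0 < f θ → 0 < φ θ) (h : 0 < mixture p f x) : 0 < mixture p φ x := by
  obtain ⟨θ, -, hθ⟩ := Finset.exists_lt_of_sum_lt (s := Finset.univ) (f := fun _ : Θ => (0 : ℝ))
    (by simpa only [mixture, Finset.sum_const_zero] using h)
  have hpθ : 0 < p x θ := pos_of_mul_pos_left hθ (hf θ)
  have hfθ : 0 < f θ := pos_of_mul_pos_right hθ (hp θ)
  exact (mul_pos hpθ (hfφ θ hfθ)).trans_le (mul_le_mixture hp hφ θ)

theorem continuous_mixture (p : 𝒳 → Θ → ℝ) (x : 𝒳) : Continuous fun φ => mixture p φ x :=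
  continuous_finsetSum _ fun θ _ => continuous_const.mul (continuous_apply θ)

theorem sum_mul_div_mixture (h : mixture p φ x ≠ 0) :
    ∑ θ, φ θ * (p x θ / mixture p φ x) = 1 := by
  simp_rw [mul_div_assoc', mul_comm (φ _), ← Finset.sum_div]
  exact div_self h

/-- One step of Newton's recursion: the update of the estimate `φ` by the observation `x` with
weight `w`. -/
noncomputable def newtonStep (p : 𝒳 → Θ → ℝ) (w : ℝ) (φ : Θ → ℝ) (x : 𝒳) : Θ → ℝ := fun θ =>
  (1 - w) * φ θ + w * (p x θ * φ θ / mixture p φ x)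

theorem newtonEstimate_succ (p : 𝒳 → Θ → ℝ) (w : ℕ → ℝ) (f₀ : Θ → ℝ) (x : ℕ → 𝒳) (n : ℕ) :
    newtonEstimate p w f₀ x (n + 1)
      = newtonStep p (w n) (newtonEstimate p w f₀ x n) (x n) :=
  rfl

theorem newtonStep_eq_mul (p : 𝒳 → Θ → ℝ) (w : ℝ) (φ : Θ → ℝ) (x : 𝒳) :
    newtonStep p w φ x = fun θ => φ θ * (1 - w + w * (p x θ / mixture p φ x)) := by
  ext θ
  rw [newtonStep]
  ring

theorem newtonStep_nonneg (hp : ∀ θ, 0 ≤ p x θ) (hφ : ∀ θ, 0 ≤ φ θ)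
    (hw : w ∈ Set.Ico (0 : ℝ) 1) (θ : Θ) : 0 ≤ newtonStep p w φ x θ := by
  rw [newtonStep_eq_mul]
  exact mul_nonneg (hφ θ)
    (one_sub_add_mul_pos hw (div_nonneg (hp θ) (mixture_nonneg hp hφ))).le

theorem newtonStep_pos (hp : ∀ θ, 0 ≤ p x θ) (hφ : ∀ θ, 0 ≤ φ θ)
    (hw : w ∈ Set.Ico (0 : ℝ) 1) {θ : Θ} (hθ : 0 < φ θ) : 0 < newtonStep p w φ x θ := by
  rw [newtonStep_eq_mul]
  exact mul_pos hθ (one_sub_add_mul_pos hw (div_nonneg (hp θ) (mixture_nonneg hp hφ)))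

theorem sum_newtonStep (h : mixture p φ x ≠ 0) (w : ℝ) :
    ∑ θ, newtonStep p w φ x θ = (1 - w) * ∑ θ, φ θ + w := by
  simp_rw [newtonStep_eq_mul, mul_add, mul_left_comm (φ _) w, Finset.sum_add_distrib,
    ← Finset.mul_sum, ← Finset.sum_mul, sum_mul_div_mixture h]
  ring

theorem newtonStep_mem_stdSimplex (hp : ∀ θ, 0 ≤ p x θ) (hφ : φ ∈ stdSimplex ℝ Θ)
    (hw : w ∈ Set.Ico (0 : ℝ) 1) (h : mixture p φ x ≠ 0) :
    newtonStep p w φ x ∈ stdSimplex ℝ Θ := by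
  refine ⟨newtonStep_nonneg hp hφ.1 hw, ?_⟩
  rw [sum_newtonStep h, hφ.2]
  ring

theorem newtonEstimate_mem_stdSimplex_and_pos {w : ℕ → ℝ} {f₀ : Θ → ℝ} {x : ℕ → 𝒳}
    (hp : ∀ x θ, 0 ≤ p x θ) (hf : ∀ θ, 0 ≤ f θ) (hw : ∀ n, w n ∈ Set.Ico (0 : ℝ) 1)
    (hf₀ : f₀ ∈ stdSimplex ℝ Θ) (hf₀_pos : ∀ θ, 0 < f θ → 0 < f₀ θ)
    (hx : ∀ n, 0 < mixture p f (x n)) (n : ℕ) :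
    newtonEstimate p w f₀ x n ∈ stdSimplex ℝ Θ ∧
      ∀ θ, 0 < f θ → 0 < newtonEstimate p w f₀ x n θ := by
  induction n with
  | zero => exact ⟨hf₀, hf₀_pos⟩
  | succ n ih =>
    obtain ⟨hmem, hpos⟩ := ih
    have hmix := mixture_pos_of_mixture_pos (hp (x n)) hf hmem.1 hpos (hx n)
    rw [newtonEstimate_succ]
    exact ⟨newtonStep_mem_stdSimplex (hp _) hmem (hw n) hmix.ne',
      fun θ hθ => newtonStep_pos (hp _) hmem.1 (hw n) (hpos θ hθ)⟩

theorem div_mixture_mul_cappedDiv_le (hp : ∀ θ, 0 ≤ p x θ) (hf : ∀ θ, 0 ≤ f θ)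
    (hx : 0 < mixture p f x) {θ : Θ} (hθ : 0 < f θ) {t : ℝ} :
    p x θ / mixture p f x * cappedDiv (mixture p f x) t ≤ 3 / f θ := by
  have hposterior : p x θ / mixture p f x ≤ 1 / f θ := by
    rw [div_le_div_iff₀ hx hθ, one_mul]
    exact mul_le_mixture hp hf θ
  calc p x θ / mixture p f x * cappedDiv (mixture p f x) t
      ≤ 1 / f θ * 3 := mul_le_mul hposterior (cappedDiv_le_three hx.le)
        (cappedDiv_nonneg hx.le) (by positivity)
    _ = 3 / f θ := by ring

theorem mul_cappedDiv_sub_le_sum_mul_log (hp : ∀ θ, 0 ≤ p x θ) (hf : f ∈ stdSimplex ℝ Θ)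
    (hw : w ∈ Set.Ico (0 : ℝ) 1) (hx : 0 < mixture p f x) {t : ℝ} (ht : 0 < t) :
    w * (cappedDiv (mixture p f x) t - 1)
        - (∑ θ, f θ * (3 / f θ + 1) ^ 2) * (w ^ 2 / (1 - w))
      ≤ ∑ θ, f θ * Real.log (1 - w + w * (p x θ / t)) := by
  set c := cappedDiv (mixture p f x) t
  have hc : 0 ≤ c := cappedDiv_nonneg hx.le
  set v : Θ → ℝ := fun θ => p x θ / mixture p f x * c
  have hv_le : ∀ θ, v θ ≤ p x θ / t := fun θ =>
    calc v θ ≤ p x θ / mixture p f x * (mixture p f x / t) :=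
          mul_le_mul_of_nonneg_left (cappedDiv_le_div hx.le ht) (div_nonneg (hp θ) hx.le)
      _ = p x θ / t := div_mul_div_cancel₀ hx.ne'
  have hsum_v : ∑ θ, f θ * (v θ - 1) = c - 1 := by
    simp_rw [v, mul_sub, mul_one, Finset.sum_sub_distrib, ← mul_assoc, ← Finset.sum_mul,
      sum_mul_div_mixture hx.ne', one_mul, hf.2]
  calc w * (c - 1) - (∑ θ, f θ * (3 / f θ + 1) ^ 2) * (w ^ 2 / (1 - w))
      = ∑ θ, f θ * (w * (v θ - 1) - (3 / f θ + 1) ^ 2 * (w ^ 2 / (1 - w))) := by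
        rw [← hsum_v, Finset.mul_sum, Finset.sum_mul, ← Finset.sum_sub_distrib]
        exact Finset.sum_congr rfl fun θ _ => by ring
    _ ≤ ∑ θ, f θ * Real.log (1 - w + w * (p x θ / t)) := Finset.sum_le_sum fun θ _ => by
        rcases (hf.1 θ).eq_or_lt with hθ | hθ
        · simp [← hθ]
        · exact mul_le_mul_of_nonneg_left (mul_sub_one_sub_le_log hw
            (mul_nonneg (div_nonneg (hp θ) hx.le) hc) (hv_le θ)
            (div_mixture_mul_cappedDiv_le hp hf.1 hx hθ)) hθ.le

theorem relEntropy_newtonStep_le (hp : ∀ θ, 0 ≤ p x θ) (hf : f ∈ stdSimplex ℝ Θ)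
    (hφ : ∀ θ, 0 ≤ φ θ) (hfφ : ∀ θ, 0 < f θ → 0 < φ θ) (hw : w ∈ Set.Ico (0 : ℝ) 1)
    (hx : 0 < mixture p f x) :
    relEntropy f (newtonStep p w φ x)
        + w * (cappedDiv (mixture p f x) (mixture p φ x) - 1)
      ≤ relEntropy f φ + (∑ θ, f θ * (3 / f θ + 1) ^ 2) * (w ^ 2 / (1 - w)) := by
  have hmix : 0 < mixture p φ x := mixture_pos_of_mixture_pos hp hf.1 hφ hfφ hx
  rw [newtonStep_eq_mul, relEntropy_mul (fun θ hθ => (hfφ θ ((hf.1 θ).lt_of_ne' hθ)).ne')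
    fun θ _ => (one_sub_add_mul_pos hw (div_nonneg (hp θ) hmix.le)).ne']
  linarith [mul_cappedDiv_sub_le_sum_mul_log hp hf hw hx hmix]

end NewtonStep

section Drift

variable {𝒳 Θ : Type*} [MeasurableSpace 𝒳] [Fintype Θ] {ν : Measure 𝒳} {p : 𝒳 → Θ → ℝ}
  {f φ : Θ → ℝ}

theorem IsProbDensity.integrable {g : 𝒳 → ℝ} (hg : IsProbDensity ν g) : Integrable g ν := by
  refine ⟨hg.measurable.aestronglyMeasurable, ?_⟩
  rw [hasFiniteIntegral_iff_ofReal (Eventually.of_forall hg.nonneg), hg.lintegral_eq_one]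
  exact ENNReal.one_lt_top

theorem IsProbDensity.integral_eq_one {g : 𝒳 → ℝ} (hg : IsProbDensity ν g) :
    ∫ x, g x ∂ν = 1 := by
  rw [integral_eq_lintegral_of_nonneg_ae (Eventually.of_forall hg.nonneg)
    hg.measurable.aestronglyMeasurable, hg.lintegral_eq_one, ENNReal.toReal_one]

theorem measurable_uncurry_mixture (hp : ∀ θ, Measurable fun x => p x θ) :
    Measurable (Function.uncurry (mixture p)) :=
  Finset.measurable_fun_sum _ fun θ _ =>
    ((hp θ).comp measurable_snd).mul ((measurable_pi_apply θ).comp measurable_fst)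

theorem measurable_mixture (hp : ∀ θ, Measurable fun x => p x θ) (φ : Θ → ℝ) :
    Measurable (mixture p φ) :=
  (measurable_uncurry_mixture hp).of_uncurry_left

theorem integrable_mixture (hp : ∀ θ, IsProbDensity ν fun x => p x θ) (φ : Θ → ℝ) :
    Integrable (mixture p φ) ν :=
  integrable_finsetSum _ fun θ _ => (hp θ).integrable.mul_const _

theorem integral_mixture (hp : ∀ θ, IsProbDensity ν fun x => p x θ) (φ : Θ → ℝ) :
    ∫ x, mixture p φ x ∂ν = ∑ θ, φ θ := by
  unfold mixture
  rw [integral_finsetSum _ fun θ _ => (hp θ).integrable.mul_const _]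
  simp only [integral_mul_const, (hp _).integral_eq_one, one_mul]

/-- The distribution with density `Π_f`, that is, the law of each observation. -/
noncomputable def mixtureLaw (ν : Measure 𝒳) (p : 𝒳 → Θ → ℝ) (f : Θ → ℝ) : Measure 𝒳 :=
  ν.withDensity fun x => ENNReal.ofReal (mixture p f x)

theorem isProbabilityMeasure_mixtureLaw (hp : ∀ θ, IsProbDensity ν fun x => p x θ)
    (hf : f ∈ stdSimplex ℝ Θ) : IsProbabilityMeasure (mixtureLaw ν p f) := by
  constructor
  rw [mixtureLaw, withDensity_apply _ MeasurableSet.univ, Measure.restrict_univ,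
    ← ofReal_integral_eq_lintegral_ofReal (integrable_mixture hp f)
      (Eventually.of_forall fun x => mixture_nonneg (fun θ => (hp θ).nonneg x) hf.1),
    integral_mixture hp, hf.2, ENNReal.ofReal_one]

theorem ae_mixtureLaw_mixture_pos (hp : ∀ θ, Measurable fun x => p x θ) (f : Θ → ℝ) :
    ∀ᵐ x ∂(mixtureLaw ν p f), 0 < mixture p f x := by
  rw [mixtureLaw, ae_withDensity_iff (measurable_mixture hp f).ennreal_ofReal]
  exact Eventually.of_forall fun x hx => ENNReal.ofReal_pos.1 (pos_iff_ne_zero.2 hx)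

theorem integral_mixtureLaw (hp : ∀ θ, IsProbDensity ν fun x => p x θ) (hf : ∀ θ, 0 ≤ f θ)
    (g : 𝒳 → ℝ) : ∫ x, g x ∂(mixtureLaw ν p f) = ∫ x, mixture p f x * g x ∂ν := by
  rw [mixtureLaw, integral_withDensity_eq_integral_toReal_smul
    (measurable_mixture (fun θ => (hp θ).measurable) f).ennreal_ofReal
    (Eventually.of_forall fun x => ENNReal.ofReal_lt_top)]
  simp only [smul_eq_mul, ENNReal.toReal_ofReal (mixture_nonneg (fun θ => (hp θ).nonneg _) hf)]

/-- A lower bound, to first order and per unit weight, for the expected decrease of the divergence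
`relEntropy f φ` in one step of the recursion from `φ`; it is obtained by capping the likelihood
ratio `Π_f / Π_φ`. -/
noncomputable def drift (ν : Measure 𝒳) (p : 𝒳 → Θ → ℝ) (f φ : Θ → ℝ) : ℝ :=
  ∫ x, cappedDiv (mixture p f x) (mixture p φ x) ∂(mixtureLaw ν p f) - 1

theorem integrable_mixture_mul_cappedDiv (hp : ∀ θ, IsProbDensity ν fun x => p x θ)
    (hf : ∀ θ, 0 ≤ f θ) (φ : Θ → ℝ) :
    Integrable (fun x => mixture p f x * cappedDiv (mixture p f x) (mixture p φ x)) ν := by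
  have hp_meas : ∀ θ, Measurable fun x => p x θ := fun θ => (hp θ).measurable
  exact (integrable_mixture hp f).mul_bdd
    (measurable_cappedDiv (measurable_mixture hp_meas f)
      (measurable_mixture hp_meas φ)).aestronglyMeasurable
    (Eventually.of_forall fun x =>
      abs_cappedDiv_le_three (mixture_nonneg (fun θ => (hp θ).nonneg x) hf))

theorem drift_eq_integral_sub_integral (hp : ∀ θ, IsProbDensity ν fun x => p x θ)
    (hf : f ∈ stdSimplex ℝ Θ) (hφ : φ ∈ stdSimplex ℝ Θ) :
    drift ν p f φ = ∫ x, mixture p f x * cappedDiv (mixture p f x) (mixture p φ x) ∂ν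
      - ∫ x, (2 * mixture p f x - mixture p φ x) ∂ν := by
  rw [drift, integral_mixtureLaw hp hf.1,
    integral_sub ((integrable_mixture hp f).const_mul 2) (integrable_mixture hp φ),
    integral_const_mul, integral_mixture hp, integral_mixture hp, hf.2, hφ.2]
  ring

theorem drift_nonneg (hp : ∀ θ, IsProbDensity ν fun x => p x θ)
    (hf : f ∈ stdSimplex ℝ Θ) (hφ : φ ∈ stdSimplex ℝ Θ) : 0 ≤ drift ν p f φ := by
  rw [drift_eq_integral_sub_integral hp hf hφ, sub_nonneg]
  refine integral_mono (((integrable_mixture hp f).const_mul 2).sub (integrable_mixture hp φ))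
    (integrable_mixture_mul_cappedDiv hp hf.1 φ) fun x => ?_
  have hpx : ∀ θ, 0 ≤ p x θ := fun θ => (hp θ).nonneg x
  exact two_mul_sub_le_mul_cappedDiv (mixture_nonneg hpx hf.1) (mixture_nonneg hpx hφ.1)

theorem mixture_ae_eq_of_drift_eq_zero (hp : ∀ θ, IsProbDensity ν fun x => p x θ)
    (hf : f ∈ stdSimplex ℝ Θ) (hφ : φ ∈ stdSimplex ℝ Θ) (h : drift ν p f φ = 0) :
    mixture p φ =ᵐ[ν] mixture p f := by
  have hpx : ∀ x θ, 0 ≤ p x θ := fun x θ => (hp θ).nonneg x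
  have hint : Integrable (fun x => 2 * mixture p f x - mixture p φ x) ν :=
    ((integrable_mixture hp f).const_mul 2).sub (integrable_mixture hp φ)
  have hle : ∀ x, 2 * mixture p f x - mixture p φ x
      ≤ mixture p f x * cappedDiv (mixture p f x) (mixture p φ x) := fun x =>
    two_mul_sub_le_mul_cappedDiv (mixture_nonneg (hpx x) hf.1) (mixture_nonneg (hpx x) hφ.1)
  rw [drift_eq_integral_sub_integral hp hf hφ, sub_eq_zero, eq_comm, integral_eq_iff_of_ae_le hint
    (integrable_mixture_mul_cappedDiv hp hf.1 φ) (Eventually.of_forall hle)] at h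
  filter_upwards [h] with x hx
  by_contra hne
  exact (two_mul_sub_lt_mul_cappedDiv (mixture_nonneg (hpx x) hf.1)
    (mixture_nonneg (hpx x) hφ.1) hne).ne hx

theorem continuous_drift (hp : ∀ θ, IsProbDensity ν fun x => p x θ) (hf : f ∈ stdSimplex ℝ Θ) :
    Continuous (drift ν p f) := by
  have := isProbabilityMeasure_mixtureLaw hp hf
  have hp_meas : ∀ θ, Measurable fun x => p x θ := fun θ => (hp θ).measurable
  refine (continuous_of_dominated (bound := fun _ => 3) (fun φ => ?_) (fun φ => ?_)
    (integrable_const _) ?_).sub continuous_const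
  · exact (measurable_cappedDiv (measurable_mixture hp_meas f)
      (measurable_mixture hp_meas φ)).aestronglyMeasurable
  · exact Eventually.of_forall fun x =>
      abs_cappedDiv_le_three (mixture_nonneg (fun θ => (hp θ).nonneg x) hf.1)
  · filter_upwards [ae_mixtureLaw_mixture_pos hp_meas f] with x hx
    exact (continuous_cappedDiv hx).comp (continuous_mixture p x)

end Drift

section Convergence

variable {𝒳 Θ : Type*} [MeasurableSpace 𝒳] [Fintype Θ] {ν : Measure 𝒳} {p : 𝒳 → Θ → ℝ}
  {f f₀ : Θ → ℝ} {w : ℕ → ℝ}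

theorem tendsto_newtonEstimate_of_tendsto_noise (hp : ∀ θ, IsProbDensity ν fun x => p x θ)
    (h_ident : ∀ φ ∈ stdSimplex ℝ Θ, mixture p φ =ᵐ[ν] mixture p f → φ = f)
    (hf : f ∈ stdSimplex ℝ Θ) (hw : ∀ n, w n ∈ Set.Ico (0 : ℝ) 1) (hw_sum : ¬ Summable w)
    (hw_sq : Summable fun n => w n ^ 2) (hf₀ : f₀ ∈ stdSimplex ℝ Θ)
    (hf₀_pos : ∀ θ, 0 < f θ → 0 < f₀ θ) {x : ℕ → 𝒳} (hx : ∀ n, 0 < mixture p f (x n))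
    (hnoise : ∃ l, Tendsto (fun n => ∑ i ∈ Finset.range n, w i *
      (cappedDiv (mixture p f (x i)) (mixture p (newtonEstimate p w f₀ x i) (x i)) - 1
        - drift ν p f (newtonEstimate p w f₀ x i))) atTop (𝓝 l)) :
    Tendsto (newtonEstimate p w f₀ x) atTop (𝓝 f) := by
  have hpx : ∀ x θ, 0 ≤ p x θ := fun x θ => (hp θ).nonneg x
  have hestimate := newtonEstimate_mem_stdSimplex_and_pos hpx hf.1 hw hf₀ hf₀_pos hx
  obtain ⟨l, hl⟩ := hnoise
  have hremainder := ((summable_sq_div_one_sub hw_sq).mul_left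
    (∑ θ, f θ * (3 / f θ + 1) ^ 2)).hasSum.tendsto_sum_nat
  have hξ := (hremainder.sub hl).congr fun n => (Finset.sum_sub_distrib _ _).symm
  refine tendsto_of_relEntropy_descent hf (fun n => (hestimate n).1) (fun n => (hestimate n).2)
    (continuous_drift hp hf).continuousOn (fun ψ hψ => drift_nonneg hp hf hψ)
    (fun ψ hψ h => h_ident ψ hψ (mixture_ae_eq_of_drift_eq_zero hp hf hψ h))
    (fun n => (hw n).1) hw_sum ⟨_, hξ⟩ fun n => ?_
  have hstep := relEntropy_newtonStep_le (hpx (x n)) hf (hestimate n).1.1 (hestimate n).2 (hw n)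
    (hx n)
  rw [newtonEstimate_succ]
  linarith

theorem measurable_newtonEstimate {Ω : Type*} {mΩ : MeasurableSpace Ω} {ℱ : Filtration ℕ mΩ}
    {X : ℕ → Ω → 𝒳} (hp : ∀ θ, Measurable fun x => p x θ)
    (hX : ∀ n, Measurable[ℱ (n + 1)] (X n)) (w : ℕ → ℝ) (f₀ : Θ → ℝ) (n : ℕ) :
    Measurable[ℱ n] fun ω => newtonEstimate p w f₀ (fun i => X i ω) n := by
  induction n with
  | zero => exact measurable_const
  | succ n ih =>
    have hφ := ih.mono (ℱ.mono n.le_succ) le_rfl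
    refine @measurable_pi_lambda _ _ _ (ℱ (n + 1)) _ _ fun θ => ?_
    have hφθ := (measurable_pi_apply θ).comp hφ
    have hmix := (measurable_uncurry_mixture hp).comp (hφ.prodMk (hX n))
    exact (hφθ.const_mul (1 - w n)).add
      (((((hp θ).comp (hX n)).mul hφθ).div hmix).const_mul (w n))

theorem ae_exists_tendsto_sum_mul_cappedDiv_sub_drift {Ω : Type*} [MeasurableSpace Ω]
    {P : Measure Ω} [IsProbabilityMeasure P] (hp : ∀ θ, IsProbDensity ν fun x => p x θ)
    (hf : ∀ θ, 0 ≤ f θ) {X : ℕ → Ω → 𝒳} (hX : ∀ n, Measurable (X n))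
    (hX_law : ∀ n, P.map (X n) = mixtureLaw ν p f) (hX_indep : iIndepFun X P)
    (hw_sq : Summable fun n => w n ^ 2) (f₀ : Θ → ℝ) :
    ∀ᵐ ω ∂P, ∃ l, Tendsto (fun n => ∑ i ∈ Finset.range n, w i *
      (cappedDiv (mixture p f (X i ω))
          (mixture p (newtonEstimate p w f₀ (fun k => X k ω) i) (X i ω)) - 1
        - drift ν p f (newtonEstimate p w f₀ (fun k => X k ω) i))) atTop (𝓝 l) := by
  have hp_meas : ∀ θ, Measurable fun x => p x θ := fun θ => (hp θ).measurable
  set ℱ := strictPast X hX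
  set φ : ℕ → Ω → Θ → ℝ := fun n ω => newtonEstimate p w f₀ (fun k => X k ω) n
  set g : (Θ → ℝ) × 𝒳 → ℝ := fun y => cappedDiv (mixture p f y.2) (mixture p y.1 y.2)
  have hg : Measurable g := measurable_cappedDiv ((measurable_mixture hp_meas f).comp
    measurable_snd) (measurable_uncurry_mixture hp_meas)
  have hφ : ∀ n, Measurable[ℱ n] (φ n) :=
    measurable_newtonEstimate hp_meas (measurable_strictPast_succ hX) w f₀
  have hG : ∀ n, StronglyMeasurable[ℱ (n + 1)] fun ω => g (φ n ω, X n ω) := fun n =>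
    (hg.comp (((hφ n).mono (ℱ.mono n.le_succ) le_rfl).prodMk
      (measurable_strictPast_succ hX n))).stronglyMeasurable
  have hG_bdd : ∀ n ω, |g (φ n ω, X n ω)| ≤ 3 := fun n ω =>
    abs_cappedDiv_le_three (mixture_nonneg (fun θ => (hp θ).nonneg _) hf)
  have hG_int : ∀ n, Integrable (fun ω => g (φ n ω, X n ω)) P := fun n =>
    Integrable.of_bound ((hG n).mono (ℱ.le _)).aestronglyMeasurable 3
      (Eventually.of_forall (hG_bdd n))
  have hG_cond : ∀ n, P[fun ω => g (φ n ω, X n ω) | ℱ n]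
      =ᵐ[P] fun ω => drift ν p f (φ n ω) + 1 := fun n => by
    filter_upwards [condExp_comp_prodMk_of_indep (ℱ.le n) (hφ n) (hX n)
      (indep_strictPast hX hX_indep n) hg (hG_int n)] with ω hω
    rw [hω, hX_law, drift, sub_add_cancel]
  filter_upwards [ae_exists_tendsto_sum_mul_sub_condExp hG hG_bdd hw_sq, ae_all_iff.2 hG_cond]
    with ω hω hω_cond
  simpa only [hω_cond, add_comm _ (1 : ℝ), ← sub_sub] using hω

end Convergence

end NewtonMixing

open NewtonMixing in
theorem theorem3p4_general {𝒳 Θ Ω : Type*} [MeasurableSpace 𝒳] [Fintype Θ] [MeasurableSpace Ω]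
    {ν : Measure 𝒳} {p : 𝒳 → Θ → ℝ} (hp : ∀ θ, IsProbDensity ν fun x => p x θ)
    {f : Θ → ℝ} (h_ident : ∀ φ ∈ stdSimplex ℝ Θ, mixture p φ =ᵐ[ν] mixture p f → φ = f)
    (hf : f ∈ stdSimplex ℝ Θ)
    {P : Measure Ω} [IsProbabilityMeasure P] {X : ℕ → Ω → 𝒳}
    (hX_law : ∀ n, HasLaw (X n) (mixtureLaw ν p f) P) (hX_indep : iIndepFun X P)
    {w : ℕ → ℝ} (hw : ∀ n, w n ∈ Set.Ico (0 : ℝ) 1)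
    (hw_sum : Tendsto (fun n => ∑ i ∈ Finset.range n, w i) atTop atTop)
    (hw_sq : Summable fun n => w n ^ 2)
    {f₀ : Θ → ℝ} (hf₀ : f₀ ∈ stdSimplex ℝ Θ) (hf₀_pos : ∀ θ, 0 < f θ → 0 < f₀ θ) :
    ∀ᵐ ω ∂P, Tendsto (newtonEstimate p w f₀ fun i => X i ω) atTop (𝓝 f) := by
  have hw_not_summable : ¬ Summable w :=
    (not_summable_iff_tendsto_nat_atTop_of_nonneg fun n => (hw n).1).2 hw_sum
  have hX_pos : ∀ n, ∀ᵐ ω ∂P, 0 < mixture p f (X n ω) := fun n =>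
    ae_of_ae_map (hX_law n).aemeasurable <| by
      rw [(hX_law n).map_eq]
      exact ae_mixtureLaw_mixture_pos (fun θ => (hp θ).measurable) f
  set Y : ℕ → Ω → 𝒳 := fun n => (hX_law n).aemeasurable.mk (X n)
  have hXY : ∀ n, X n =ᵐ[P] Y n := fun n => (hX_law n).aemeasurable.ae_eq_mk
  have hY_law : ∀ n, P.map (Y n) = mixtureLaw ν p f := fun n =>
    (Measure.map_congr (hXY n)).symm.trans (hX_law n).map_eq
  filter_upwards [ae_exists_tendsto_sum_mul_cappedDiv_sub_drift hp hf.1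
      (fun n => (hX_law n).aemeasurable.measurable_mk) hY_law (hX_indep.congr hXY) hw_sq f₀,
    ae_all_iff.2 hX_pos, ae_all_iff.2 hXY] with ω hnoise hpos hω
  simp only [hω] at hpos ⊢
  exact tendsto_newtonEstimate_of_tendsto_noise hp h_ident hf hw hw_not_summable hw_sq hf₀ hf₀_pos
    hpos hnoise

theorem theorem3p4 {𝒳 Θ Ω : Type*} [MeasurableSpace 𝒳] [Fintype Θ] [MeasurableSpace Ω]
    (ν : Measure 𝒳) [SigmaFinite ν]
    (p : 𝒳 → Θ → ℝ)
    (hp : ∀ θ, NewtonMixing.IsProbDensity ν (fun x => p x θ))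
    (hp_pos : ∀ θ, ∀ᵐ x ∂ν, 0 < p x θ)
    (h_ident : NewtonMixing.Identifiable ν p)
    (f : Θ → ℝ) (hf : f ∈ stdSimplex ℝ Θ)
    (P : Measure Ω) [IsProbabilityMeasure P]
    (X : ℕ → Ω → 𝒳)
    (hX_law : ∀ n,
      HasLaw (X n) (ν.withDensity fun x => ENNReal.ofReal (NewtonMixing.mixture p f x)) P)
    (hX_indep : iIndepFun X P)
    (w : ℕ → ℝ) (hw : ∀ n, w n ∈ Set.Ioo (0 : ℝ) 1)
    (hw_sum : Tendsto (fun n => ∑ i ∈ Finset.range n, w i) atTop atTop)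
    (hw_sq : Summable fun n => w n ^ 2)
    (f₀ : Θ → ℝ) (hf₀ : f₀ ∈ stdSimplex ℝ Θ) (hf₀_pos : ∀ θ, 0 < f₀ θ) :
    ∀ᵐ ω ∂P,
      Tendsto (fun n => NewtonMixing.newtonEstimate p w f₀ (fun i => X i ω) n) atTop (𝓝 f) := by
  exact theorem3p4_general hp (fun φ hφ => h_ident φ hφ f hf) hf hX_law hX_indep
    (fun n => Set.Ioo_subset_Ico_self (hw n)) hw_sum hw_sq hf₀ fun θ _ => hf₀_pos θ
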